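/- Let $\mathcal S=\{(0,1),(1,-1),(-1,-1),(-2,1)\}\subset\mathbb Z^2$. For $i,j,n\ge 0$ let $q(i,j;n)$ be the number of $n$-step walks from $(0,0)$ to $(i,j)$ with steps in $\mathcal S$ all of whose points lie in $\{(k,\ell)\in\mathbb Z^2: k,\ell\ge 0\}$, and let $Q(x,y)=\sum_{i,j,n\ge 0}q(i,j;n)x^iy^jt^n$. For a power series $F$ in $t$ with coefficients in $\mathbb Q[x,x^{-1},y,y^{-1}]$, let $[x^{\ge}y^{\ge}]F$ be the series obtained by keeping only the monomials $x^iy^jt^n$ with $i\ge 0$ and $j\ge 0$. Then $$Q(x,y)=[x^{\ge}y^{\ge}]\,\frac{(x^3-2y^2-x)(y^2-x)(x^2y^2-y^2-2x)}{x^5y^4\left(1-t\,(y+xy^{-1}+x^{-1}y^{-1}+x^{-2}y)\right)},$$ where the right-hand side is seen as a power series in $t$ with coefficients in $\mathbb Q[x,x^{-1},y,y^{-1}]$. Moreover $q(i,j;n)=0$ unless $n=2i+j+4m$ for some integer $m\ge 0$, in which case $$q(i,j;n)=\frac{(i+1)(j+1)(i+j+2)\,n!\,(n+2)!}{m!\,(3m+2i+j+2)!\,(2m+i+1)!\,(2m+i+j+2)!}.$$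 Finally, the excursion exponent $\alpha_e$ and the walk exponent $\alpha_w$ of $\mathcal S$ are both $-4$, in the following sense. Say that a sequence $(u_n)$ of non-negative integers has growth constant $\mu>0$ and exponent $\alpha$ if there are an integer $p\ge 1$ and constants $\kappa_0,\dots,\kappa_{p-1}\ge 0$, not all zero, such that for each $r\in\{0,\dots,p-1\}$, as $n\to\infty$ with $n\equiv r \pmod p$, one has $u_n\sim\kappa_r\,\mu^n n^{\alpha}$ if $\kappa_r>0$, and $u_n=0$ for all large $n$ if $\kappa_r=0$. * (Excursions.) The step polynomial $S(x,y)=\sum_{(k,\ell)\in\mathcal S}x^ky^\ell$ has a unique critical point $(a,b)$ in $\mathbb R_{>0}^2$; there $S_{xx}(a,b)>0$ and $S_{yy}(a,b)>0$; with $c=S_{xy}(a,b)/\sqrt{S_{xx}(a,b)S_{yy}(a,b)}$ one has $\alpha_e:=-1-\pi/\arccos(-c)=-4$; and the sequence $(q(0,0;n))_n$ has growth constant $S(a,b)$ and exponent $-4$. * (Walks.) The sequence $\left(\sum_{i,j\ge 0}q(i,j;n)\right)_n$ of coefficients of $Q(1,1)$ has exponent $-4$, for some growth constant $\mu>0$.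 -/

import Mathlib

open Filter Asymptotics

namespace QuadrantWalk

/-- The point reached after the first `k` steps of the walk that starts at `(0,0)` and takes
successively the steps `w 0, w 1, …, w (n-1)`. -/
def position {n : ℕ} (w : Fin n → ℤ × ℤ) (k : ℕ) : ℤ × ℤ :=
  ∑ l ∈ (Finset.univ : Finset (Fin n)).filter (fun l => l.val < k), w l

/-- The final point of a walk of length `n` that starts at `(0,0)`. -/
def endpoint {n : ℕ} (w : Fin n → ℤ × ℤ) : ℤ × ℤ := position w n

/-- The walk visits only points of the quadrant `{(i,j) : i ≥ 0, j ≥ 0}`. -/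
def StaysInQuadrant {n : ℕ} (w : Fin n → ℤ × ℤ) : Prop :=
  ∀ k : ℕ, k ≤ n → 0 ≤ (position w k).1 ∧ 0 ≤ (position w k).2

instance {n : ℕ} : DecidablePred (StaysInQuadrant (n := n)) := fun w =>
  decidable_of_iff (∀ k : Fin (n + 1), 0 ≤ (position w k).1 ∧ 0 ≤ (position w k).2)
    ⟨fun h k hk => h ⟨k, Nat.lt_succ_of_le hk⟩, fun h k => h k (Nat.le_of_lt_succ k.2)⟩

/-- The quadrant walks of length `n` that start at `(0,0)` and take their steps in `S`. -/
def walks (S : Finset (ℤ × ℤ)) (n : ℕ) : Finset (Fin n → ℤ × ℤ) :=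
  (Fintype.piFinset fun _ : Fin n => S).filter StaysInQuadrant

/-- The number `q(i,j;n)` of quadrant walks of length `n` from `(0,0)` to `e = (i,j)`. -/
def q (S : Finset (ℤ × ℤ)) (e : ℤ × ℤ) (n : ℕ) : ℕ :=
  ((walks S n).filter fun w => endpoint w = e).card

/-- The total number of quadrant walks of length `n`, that is, the coefficient of `t ^ n` in
`Q(1,1;t)`. -/
def total (S : Finset (ℤ × ℤ)) (n : ℕ) : ℕ := (walks S n).card

/-- The ring `ℚ[x, x⁻¹, y, y⁻¹]` of Laurent polynomials; the element `single (i, j) c` is the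
monomial `c x ^ i y ^ j`. -/
abbrev Laurent : Type := AddMonoidAlgebra ℚ (ℤ × ℤ)

/-- The monomial `x ^ i y ^ j`. -/
noncomputable def mon (i j : ℤ) : Laurent := AddMonoidAlgebra.single (i, j) 1

/-- The generating function `Q(x,y;t) = ∑ q(i,j;n) x ^ i y ^ j t ^ n`, a power series in `t` with
coefficients in `ℚ[x, x⁻¹, y, y⁻¹]` (in fact in `ℚ[x, y]`). -/
noncomputable def Q (S : Finset (ℤ × ℤ)) : PowerSeries Laurent :=
  PowerSeries.mk fun n => AddMonoidAlgebra.ofCoeff <|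
    Finsupp.onFinset ((walks S n).image endpoint) (fun e => (q S e n : ℚ)) (by
      intro e he
      obtain ⟨w, hw⟩ := Finset.card_ne_zero.mp (fun h => he (by exact_mod_cast h))
      rw [Finset.mem_filter] at hw
      exact Finset.mem_image.mpr ⟨w, hw.1, hw.2⟩)

/-- The non-negative part `[x^≥ y^≥] F` of a power series `F` in `t` with coefficients in
`ℚ[x, x⁻¹, y, y⁻¹]`: only the monomials `x ^ i y ^ j t ^ n` with `i ≥ 0` and `j ≥ 0` are kept. -/
noncomputable def nonnegPart (F : PowerSeries Laurent) : PowerSeries Laurent :=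
  PowerSeries.mk fun n => AddMonoidAlgebra.ofCoeff <|
    ((PowerSeries.coeff n F).coeff).filter fun e => 0 ≤ e.1 ∧ 0 ≤ e.2

/-- The sequence `u` has growth constant `μ > 0` and critical exponent `α`: for some period
`p ≥ 1` and some non-negative constants `κ_0, …, κ_{p-1}`, not all zero,
`u(n) ~ κ_r μ ^ n n ^ α` as `n → ∞` with `n ≡ r` modulo `p`. In a residue class with
`κ_r = 0` this means that `u(n) = 0` for all large `n`. -/
def HasGrowth (u : ℕ → ℕ) (μ α : ℝ) : Prop :=
  0 < μ ∧ ∃ p : ℕ, 0 < p ∧ ∃ κ : Fin p → ℝ, (∀ r, 0 ≤ κ r) ∧ (∃ r, 0 < κ r) ∧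
    ∀ r : Fin p, (fun m : ℕ => (u (p * m + r) : ℝ)) ~[atTop]
      fun m : ℕ => κ r * μ ^ (p * m + r : ℕ) * ((p * m + r : ℕ) : ℝ) ^ α

/-- The step polynomial `S(x,y) = ∑ x ^ i y ^ j`, the sum being over the steps `(i,j)`. -/
noncomputable def stepPoly (S : Finset (ℤ × ℤ)) (x y : ℝ) : ℝ := ∑ s ∈ S, x ^ s.1 * y ^ s.2

/-- `(a,b)` is a critical point of the step polynomial in the open positive quadrant. -/
def IsPosCritical (S : Finset (ℤ × ℤ)) (a b : ℝ) : Prop :=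
  0 < a ∧ 0 < b ∧ deriv (fun x => stepPoly S x b) a = 0 ∧ deriv (fun y => stepPoly S a y) b = 0

/-- `S_xx(a,b)`. -/
noncomputable def dxx (S : Finset (ℤ × ℤ)) (a b : ℝ) : ℝ :=
  deriv (deriv fun x => stepPoly S x b) a

/-- `S_yy(a,b)`. -/
noncomputable def dyy (S : Finset (ℤ × ℤ)) (a b : ℝ) : ℝ :=
  deriv (deriv fun y => stepPoly S a y) b

/-- `S_xy(a,b)`. -/
noncomputable def dxy (S : Finset (ℤ × ℤ)) (a b : ℝ) : ℝ :=
  deriv (fun y => deriv (fun x => stepPoly S x y) a) b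

/-- `α` is the excursion exponent of the model `S`: the step polynomial has a unique positive
critical point `(a,b)`, at which `S_xx` and `S_yy` are positive,
`α = -1 - π / arccos (-c)` with `c = S_xy / √(S_xx S_yy)` at `(a,b)`, and the numbers
`q(0,0;n)` of quadrant excursions have growth constant `S(a,b)` and critical exponent `α`. -/
def IsExcursionExponent (S : Finset (ℤ × ℤ)) (α : ℝ) : Prop :=
  ∃ a b : ℝ, IsPosCritical S a b ∧
    (∀ a' b' : ℝ, IsPosCritical S a' b' → a' = a ∧ b' = b) ∧
    0 < dxx S a b ∧ 0 < dyy S a b ∧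
    α = -1 - Real.pi / Real.arccos (-(dxy S a b / √(dxx S a b * dyy S a b))) ∧
    HasGrowth (q S (0, 0)) (stepPoly S a b) α

/-- `α` is the walk exponent of the model `S`: the critical exponent of the sequence of total
numbers of quadrant walks of length `n`. -/
def IsWalkExponent (S : Finset (ℤ × ℤ)) (α : ℝ) : Prop :=
  ∃ μ : ℝ, HasGrowth (total S) μ α

/-- The model `{01, 11̄, 1̄1̄, 2̄1}`, where a bar denotes a minus sign. -/
def steps : Finset (ℤ × ℤ) := {(0, 1), (1, -1), (-1, -1), (-2, 1)}

/-- The numerator `(x³ - 2y² - x)(y² - x)(x²y² - y² - 2x)`. -/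
noncomputable def numer : Laurent :=
  (mon 3 0 - 2 * mon 0 2 - mon 1 0) * (mon 0 2 - mon 1 0) * (mon 2 2 - mon 0 2 - 2 * mon 1 0)

/-- The denominator `x⁵y⁴ (1 - t (y + x y⁻¹ + x⁻¹ y⁻¹ + x⁻² y))`, as a power series in `t`. -/
noncomputable def denom : PowerSeries Laurent :=
  PowerSeries.C (mon 5 4) *
    (1 - PowerSeries.X * PowerSeries.C (mon 0 1 + mon 1 (-1) + mon (-1) (-1) + mon (-2) 1))

end QuadrantWalk

namespace QuadrantWalk

/-! The whole statement rests on an explicit function `closedForm` defined for all integers `i`,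
`j`. By `closedForm_succ` it satisfies the one-step recursion of the walks on all of `ℤ × ℤ`, with
no boundary correction, because `1/z!` extended by zero obeys `1/(z-1)! = z · 1/z!` everywhere. Its
factors `i+1` and `j+1` make it vanish on the lines `i = -1` and `j = -1`, and at `n = 0` it is the
unit mass at the origin when restricted to the quadrant. Hence it counts quadrant walks
(`q_steps_eq_closedForm`). On the full plane its values at `n = 0` are the coefficients of `numer /
(x⁵y⁴)`, so the same recursion identifies it with all coefficients of the rational function
(`coeff_quotient`); restricting to the quadrant gives `Q`.

For the asymptotics, the critical point is `(b², b)` with `b⁴ = 3`, and `S = 8b/3` there. Stirling's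
formula gives `q(i,j;n) ~ κ μⁿ n⁻⁴` along the admissible residue class, with `μ = 8b/3`, for each
fixed endpoint (`tendsto_q_steps`). The totals follow by dominated convergence over endpoints. The
domination `q_steps_mul_le` comes from writing `q` as a product of two binomial coefficients, each
bounded by its maximal size of order `1/√n`; it decays like `b^(-(2i+j))`, which is summable since
`b > 1`. So walks and excursions share both growth constant and exponent. -/

/-! ### Last-step recursion for the walk counts. -/

lemma position_snoc {n : ℕ} (w : Fin n → ℤ × ℤ) (s : ℤ × ℤ) {k : ℕ} (hk : k ≤ n) :
    position (Fin.snoc w s : Fin (n + 1) → ℤ × ℤ) k = position w k := by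
  simp [position, Finset.sum_filter, Fin.sum_univ_castSucc, hk]

lemma endpoint_snoc {n : ℕ} (w : Fin n → ℤ × ℤ) (s : ℤ × ℤ) :
    endpoint (Fin.snoc w s : Fin (n + 1) → ℤ × ℤ) = endpoint w + s := by
  simp [endpoint, position, Finset.sum_filter, Fin.sum_univ_castSucc]

lemma snoc_mem_walks {S : Finset (ℤ × ℤ)} {n : ℕ} (w : Fin n → ℤ × ℤ) (s : ℤ × ℤ) :
    (Fin.snoc w s : Fin (n + 1) → ℤ × ℤ) ∈ walks S (n + 1) ↔
      w ∈ walks S n ∧ s ∈ S ∧ 0 ≤ (endpoint w + s).1 ∧ 0 ≤ (endpoint w + s).2 := by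
  have hS : (∀ l : Fin (n + 1), (Fin.snoc w s : Fin (n + 1) → ℤ × ℤ) l ∈ S) ↔
      (∀ l, w l ∈ S) ∧ s ∈ S := by
    rw [Fin.forall_fin_succ']
    simp
  have hQ : StaysInQuadrant (Fin.snoc w s : Fin (n + 1) → ℤ × ℤ) ↔
      StaysInQuadrant w ∧ 0 ≤ (endpoint w + s).1 ∧ 0 ≤ (endpoint w + s).2 := by
    rw [← endpoint_snoc]
    constructor
    · intro h
      refine ⟨fun k hk => ?_, h (n + 1) le_rfl⟩
      rw [← position_snoc w s hk]
      exact h k (by omega)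
    · rintro ⟨h, h'⟩ k hk
      rcases Nat.lt_or_ge n k with hlt | hle
      · obtain rfl : k = n + 1 := by omega
        exact h'
      · rw [position_snoc w s hle]
        exact h k hle
  rw [walks, walks, Finset.mem_filter, Finset.mem_filter, Fintype.mem_piFinset,
    Fintype.mem_piFinset, hS, hQ]
  tauto

lemma q_of_neg {S : Finset (ℤ × ℤ)} {e : ℤ × ℤ} (n : ℕ) (he : ¬ (0 ≤ e.1 ∧ 0 ≤ e.2)) :
    q S e n = 0 := by
  rw [q, Finset.card_eq_zero, Finset.filter_eq_empty_iff]
  rintro w hw rfl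
  exact he ((Finset.mem_filter.mp hw).2 n le_rfl)

lemma q_zero (S : Finset (ℤ × ℤ)) (e : ℤ × ℤ) : q S e 0 = if e = 0 then 1 else 0 := by
  have hw : walks S 0 = Finset.univ := by
    ext w
    simp [walks, StaysInQuadrant, position]
  rw [q, hw]
  split_ifs with h
  · subst h
    rw [Finset.filter_true_of_mem]
    · simp
    · intro w _
      simp [endpoint, position]
  · rw [Finset.card_eq_zero, Finset.filter_eq_empty_iff]
    rintro w _ rfl
    exact h (by simp [endpoint, position])

lemma q_succ {S : Finset (ℤ × ℤ)} {e : ℤ × ℤ} (n : ℕ) (he : 0 ≤ e.1 ∧ 0 ≤ e.2) :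
    q S e (n + 1) = ∑ s ∈ S, q S (e - s) n := by
  rw [q, Finset.card_eq_sum_card_fiberwise (f := fun w => w (Fin.last n)) (t := S)]
  · refine Finset.sum_congr rfl fun s hs => ?_
    rw [q]
    symm
    refine Finset.card_bij (fun w _ => Fin.snoc w s) ?_ ?_ ?_
    · intro w hw
      rw [Finset.mem_filter] at hw
      have h : endpoint w + s = e := by rw [hw.2, sub_add_cancel]
      rw [Finset.mem_filter, Finset.mem_filter, snoc_mem_walks, endpoint_snoc, h]
      simpa [hs, hw.1] using he
    · intro w _ w' _ h
      exact (Fin.snoc_injective2 h).1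
    · intro w hw
      induction w using Fin.snocCases with
      | snoc w s' =>
        rw [Finset.mem_filter, Finset.mem_filter, snoc_mem_walks, endpoint_snoc,
          Fin.snoc_last] at hw
        obtain ⟨⟨hw, rfl⟩, rfl⟩ := hw
        exact ⟨w, Finset.mem_filter.mpr ⟨hw.1, by simp⟩, rfl⟩
  · intro w hw
    have h := (Finset.mem_filter.mp (Finset.mem_filter.mp hw).1).1
    exact Fintype.mem_piFinset.mp h _

lemma q_steps_succ {i j : ℤ} (n : ℕ) (hi : 0 ≤ i) (hj : 0 ≤ j) :
    q steps (i, j) (n + 1) = q steps (i, j - 1) n + q steps (i - 1, j + 1) n +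
      q steps (i + 1, j + 1) n + q steps (i + 2, j - 1) n := by
  rw [q_succ n ⟨hi, hj⟩, steps]
  rw [Finset.sum_insert (by decide), Finset.sum_insert (by decide), Finset.sum_insert (by decide),
    Finset.sum_singleton]
  simp [add_assoc]

/-! ### The closed form on the whole lattice. -/

/-- The inverse factorial `1 / z!`, extended by zero to the negative integers. -/
def invFactorial (z : ℤ) : ℚ := if z < 0 then 0 else ((z.toNat.factorial : ℕ) : ℚ)⁻¹

lemma invFactorial_natCast (k : ℕ) : invFactorial k = ((k.factorial : ℕ) : ℚ)⁻¹ := by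
  simp [invFactorial]

lemma invFactorial_of_neg {z : ℤ} (hz : z < 0) : invFactorial z = 0 := if_pos hz

/-- At `z = 0` both sides vanish, so no sign condition is needed; this lets the recursion below
cross the boundary of the support. -/
lemma invFactorial_sub_one (z : ℤ) : invFactorial (z - 1) = z * invFactorial z := by
  rcases lt_trichotomy z 0 with h | rfl | h
  · rw [invFactorial_of_neg h, invFactorial_of_neg (by omega), mul_zero]
  · simp [invFactorial]
  · obtain ⟨k, rfl⟩ : ∃ k : ℕ, z = k + 1 := ⟨(z - 1).toNat, by omega⟩
    rw [add_sub_cancel_right, invFactorial_natCast, ← Nat.cast_succ, invFactorial_natCast,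
      Nat.factorial_succ]
    have : (k.factorial : ℚ) ≠ 0 := by positivity
    push_cast
    field_simp

/-- The closed form of the number of quadrant walks from `(0, 0)` to `(i, j)` of length `n`,
extended to all integers `i` and `j`. -/
def closedForm (i j : ℤ) (n : ℕ) : ℚ :=
  if 4 ∣ (n : ℤ) - 2 * i - j then
    (i + 1) * (j + 1) * (i + j + 2) * n.factorial * (n + 2).factorial *
      (invFactorial ((n - 2 * i - j) / 4) * invFactorial (n - (n - 2 * i - j) / 4 + 2) *
        invFactorial (2 * ((n - 2 * i - j) / 4) + i + 1) *
        invFactorial (2 * ((n - 2 * i - j) / 4) + i + j + 2))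
  else 0

lemma closedForm_of_eq {i j : ℤ} {n : ℕ} {m : ℤ} (h : (n : ℤ) = 2 * i + j + 4 * m) :
    closedForm i j n = (i + 1) * (j + 1) * (i + j + 2) * n.factorial * (n + 2).factorial *
      (invFactorial m * invFactorial (3 * m + 2 * i + j + 2) *
        invFactorial (2 * m + i + 1) * invFactorial (2 * m + i + j + 2)) := by
  have hm : ((n : ℤ) - 2 * i - j) / 4 = m := by omega
  rw [closedForm, if_pos ⟨m, by omega⟩, hm,
    show (n : ℤ) - m + 2 = 3 * m + 2 * i + j + 2 by omega]

lemma closedForm_of_not_dvd {i j : ℤ} {n : ℕ} (h : ¬ 4 ∣ (n : ℤ) - 2 * i - j) :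
    closedForm i j n = 0 := if_neg h

lemma closedForm_of_neg {i j : ℤ} {n : ℕ} (h : (n : ℤ) < 2 * i + j) : closedForm i j n = 0 := by
  by_cases hd : 4 ∣ (n : ℤ) - 2 * i - j
  · obtain ⟨m, hm⟩ := hd
    rw [closedForm_of_eq (m := m) (by omega), invFactorial_of_neg (by omega : m < 0)]
    ring
  · exact closedForm_of_not_dvd hd

lemma closedForm_neg_one_left (j : ℤ) (n : ℕ) : closedForm (-1) j n = 0 := by
  simp [closedForm]

lemma closedForm_neg_one_right (i : ℤ) (n : ℕ) : closedForm i (-1) n = 0 := by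
  simp [closedForm]

/-- Each step changes `2i + j` by `1` or `-3`, so the first two predecessors keep the parameter `m`
and the last two have `m - 1`. All terms then share the same product of inverse factorials, and what
remains is a polynomial identity in `i`, `j`, `m`. -/
lemma closedForm_succ (i j : ℤ) (n : ℕ) :
    closedForm i j (n + 1) = closedForm i (j - 1) n + closedForm (i - 1) (j + 1) n +
      closedForm (i + 1) (j + 1) n + closedForm (i + 2) (j - 1) n := by
  by_cases hd : 4 ∣ ((n + 1 : ℕ) : ℤ) - 2 * i - j
  · obtain ⟨m, hm⟩ := hd
    push_cast at hm
    rw [closedForm_of_eq (m := m) (i := i) (j := j) (by push_cast; omega),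
      closedForm_of_eq (m := m) (i := i) (by omega),
      closedForm_of_eq (m := m) (i := i - 1) (by omega),
      closedForm_of_eq (m := m - 1) (i := i + 1) (by omega),
      closedForm_of_eq (m := m - 1) (i := i + 2) (by omega)]
    have hn : (n : ℚ) = 2 * i + j + 4 * m - 1 := by
      have : (n : ℤ) = 2 * i + j + 4 * m - 1 := by omega
      exact_mod_cast this
    rw [show 3 * m + 2 * i + (j - 1) + 2 = 3 * m + 2 * i + j + 2 - 1 by ring,
      show 2 * m + i + (j - 1) + 2 = 2 * m + i + j + 2 - 1 by ring,
      show 3 * m + 2 * (i - 1) + (j + 1) + 2 = 3 * m + 2 * i + j + 2 - 1 by ring,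
      show 2 * m + (i - 1) + 1 = 2 * m + i + 1 - 1 by ring,
      show 2 * m + (i - 1) + (j + 1) + 2 = 2 * m + i + j + 2 by ring,
      show 3 * (m - 1) + 2 * (i + 1) + (j + 1) + 2 = 3 * m + 2 * i + j + 2 by ring,
      show 2 * (m - 1) + (i + 1) + 1 = 2 * m + i + 1 - 1 by ring,
      show 2 * (m - 1) + (i + 1) + (j + 1) + 2 = 2 * m + i + j + 2 by ring,
      show 3 * (m - 1) + 2 * (i + 2) + (j - 1) + 2 = 3 * m + 2 * i + j + 2 by ring,
      show 2 * (m - 1) + (i + 2) + 1 = 2 * m + i + 1 by ring,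
      show 2 * (m - 1) + (i + 2) + (j - 1) + 2 = 2 * m + i + j + 2 - 1 by ring,
      show n + 1 + 2 = n + 2 + 1 by ring]
    simp only [invFactorial_sub_one, Nat.factorial_succ n, Nat.factorial_succ (n + 2)]
    push_cast
    rw [hn]
    ring
  · push_cast at hd
    rw [closedForm_of_not_dvd (by push_cast; exact hd),
      closedForm_of_not_dvd (i := i) (by omega), closedForm_of_not_dvd (i := i - 1) (by omega),
      closedForm_of_not_dvd (i := i + 1) (by omega), closedForm_of_not_dvd (i := i + 2) (by omega)]
    ring

lemma closedForm_zero {i j : ℤ} (hi : 0 ≤ i) (hj : 0 ≤ j) :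
    closedForm i j 0 = if (i, j) = (0, 0) then 1 else 0 := by
  rcases eq_or_ne (i, j) (0, 0) with h | h
  · obtain ⟨rfl, rfl⟩ := Prod.mk.inj h
    rw [closedForm_of_eq (m := 0) (by simp)]
    have h2 : invFactorial 2 = 2⁻¹ := invFactorial_natCast 2
    have h1 : invFactorial 1 = 1 := by simpa using invFactorial_natCast 1
    have h0 : invFactorial 0 = 1 := by simpa using invFactorial_natCast 0
    norm_num [h0, h1, h2]
  · rw [if_neg h]
    have : i ≠ 0 ∨ j ≠ 0 := by
      by_contra! h'
      exact h (by rw [h'.1, h'.2])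
    exact closedForm_of_neg (by push_cast; omega)

/-- No step raises a coordinate by more than one, so predecessors of quadrant points stay in `i, j ≥
-1`; including these two lines, where both sides vanish, closes the induction on `n`. -/
lemma q_steps_eq_closedForm (n : ℕ) {i j : ℤ} (hi : -1 ≤ i) (hj : -1 ≤ j) :
    (q steps (i, j) n : ℚ) = closedForm i j n := by
  have boundary : ∀ (n : ℕ) (i j : ℤ), i = -1 ∨ j = -1 →
      (q steps (i, j) n : ℚ) = closedForm i j n := by
    rintro n i j (rfl | rfl)
    · rw [closedForm_neg_one_left, q_of_neg n (by simp), Nat.cast_zero]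
    · rw [closedForm_neg_one_right, q_of_neg n (by simp), Nat.cast_zero]
  induction n generalizing i j with
  | zero =>
    rcases hi.eq_or_lt with h | hi'
    · exact boundary 0 i j (Or.inl h.symm)
    rcases hj.eq_or_lt with h | hj'
    · exact boundary 0 i j (Or.inr h.symm)
    rw [q_zero, closedForm_zero (by omega) (by omega)]
    push_cast
    rfl
  | succ n ih =>
    rcases hi.eq_or_lt with h | hi'
    · exact boundary _ i j (Or.inl h.symm)
    rcases hj.eq_or_lt with h | hj'
    · exact boundary _ i j (Or.inr h.symm)
    rw [q_steps_succ n (by omega) (by omega), closedForm_succ]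
    push_cast
    rw [ih (by omega) (by omega), ih (by omega) (by omega), ih (by omega) (by omega),
      ih (by omega) (by omega)]

lemma q_steps_eq_zero {i j n : ℕ} (h : ¬ ∃ m : ℕ, n = 2 * i + j + 4 * m) :
    q steps ((i : ℤ), (j : ℤ)) n = 0 := by
  have key : closedForm i j n = 0 := by
    by_cases hd : 4 ∣ (n : ℤ) - 2 * i - j
    · obtain ⟨m, hm⟩ := hd
      refine closedForm_of_neg ?_
      by_contra! h'
      exact h ⟨m.toNat, by omega⟩
    · exact closedForm_of_not_dvd hd
  have := q_steps_eq_closedForm n (i := i) (j := j) (by omega) (by omega)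
  rw [key] at this
  exact_mod_cast this

lemma q_steps_eq {i j m n : ℕ} (h : n = 2 * i + j + 4 * m) :
    (q steps ((i : ℤ), (j : ℤ)) n : ℚ) =
      (((i + 1) * (j + 1) * (i + j + 2) * n.factorial * (n + 2).factorial : ℕ) : ℚ) /
        ((m.factorial * (3 * m + 2 * i + j + 2).factorial * (2 * m + i + 1).factorial *
          (2 * m + i + j + 2).factorial : ℕ) : ℚ) := by
  rw [q_steps_eq_closedForm n (by omega) (by omega),
    closedForm_of_eq (m := m) (by rw [h]; push_cast; ring)]
  have h1 : 3 * (m : ℤ) + 2 * i + j + 2 = ((3 * m + 2 * i + j + 2 : ℕ) : ℤ) := by push_cast; ring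
  have h2 : 2 * (m : ℤ) + i + 1 = ((2 * m + i + 1 : ℕ) : ℤ) := by push_cast; ring
  have h3 : 2 * (m : ℤ) + i + j + 2 = ((2 * m + i + j + 2 : ℕ) : ℤ) := by push_cast; ring
  rw [h1, h2, h3]
  simp only [invFactorial_natCast]
  push_cast
  rw [div_eq_mul_inv]
  simp only [mul_inv]

/-! ### Expansion of the rational function. -/

lemma mon_mul_mon (i j k l : ℤ) : mon i j * mon k l = mon (i + k) (j + l) := by
  simp [mon, AddMonoidAlgebra.single_mul_single]

lemma coeff_mon (i j k l : ℤ) : (mon i j).coeff (k, l) = if i = k ∧ j = l then 1 else 0 := by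
  simp [mon, Finsupp.single_apply]

lemma coeff_mon_mul (i j : ℤ) (F : Laurent) (k l : ℤ) :
    (mon i j * F).coeff (k, l) = F.coeff (k - i, l - j) := by
  rw [mon, AddMonoidAlgebra.coeff_single_mul_apply, one_mul]
  congr 1
  ext <;> simp <;> ring

/-- The Laurent polynomial `y + x y⁻¹ + x⁻¹ y⁻¹ + x⁻² y`. -/
noncomputable def stepLaurent : Laurent := mon 0 1 + mon 1 (-1) + mon (-1) (-1) + mon (-2) 1

/-- The monomial `x⁵y⁴` is a unit, so comparing coefficients of `t` turns the equation into a
first-order recursion. -/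
lemma denom_mul_eq_iff (R : PowerSeries Laurent) :
    denom * R = PowerSeries.C numer ↔
      PowerSeries.coeff 0 R = mon (-5) (-4) * numer ∧
        ∀ n, PowerSeries.coeff (n + 1) R = stepLaurent * PowerSeries.coeff n R := by
  have hu : mon 5 4 * mon (-5) (-4) = 1 := mon_mul_mon 5 4 (-5) (-4)
  have hcancel : ∀ a b : Laurent, mon 5 4 * a = b ↔ a = mon (-5) (-4) * b := by
    intro a b
    constructor
    · rintro rfl
      rw [← mul_assoc, mul_comm (mon _ _) (mon _ _), hu, one_mul]
    · rintro rfl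
      rw [← mul_assoc, hu, one_mul]
  have hd : denom * R = PowerSeries.C (mon 5 4) *
      (R - PowerSeries.X * (PowerSeries.C stepLaurent * R)) := by
    rw [denom, stepLaurent]
    ring
  rw [hd, PowerSeries.ext_iff]
  constructor
  · intro h
    refine ⟨?_, fun n => ?_⟩
    · have h0 := h 0
      rw [PowerSeries.coeff_C_mul, map_sub, PowerSeries.coeff_zero_X_mul, sub_zero,
        PowerSeries.coeff_zero_C] at h0
      exact (hcancel _ _).mp h0
    · have h1 := h (n + 1)
      rw [PowerSeries.coeff_C_mul, map_sub, PowerSeries.coeff_succ_X_mul,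
        PowerSeries.coeff_C_mul, PowerSeries.coeff_C, if_neg n.succ_ne_zero, hcancel,
        mul_zero, sub_eq_zero] at h1
      exact h1
  · rintro ⟨h0, h1⟩ n
    rw [PowerSeries.coeff_C_mul, map_sub]
    cases n with
    | zero =>
      rw [PowerSeries.coeff_zero_X_mul, sub_zero, PowerSeries.coeff_zero_C]
      exact (hcancel _ _).mpr h0
    | succ n =>
      rw [PowerSeries.coeff_succ_X_mul, PowerSeries.coeff_C_mul, PowerSeries.coeff_C,
        if_neg n.succ_ne_zero, h1, sub_self, mul_zero]

lemma existsUnique_quotient :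
    ∃! R : PowerSeries Laurent, denom * R = PowerSeries.C numer := by
  refine ⟨PowerSeries.mk fun n => stepLaurent ^ n * (mon (-5) (-4) * numer), ?_, ?_⟩
  · refine (denom_mul_eq_iff _).mpr ⟨by simp, fun n => ?_⟩
    simp only [PowerSeries.coeff_mk]
    ring
  · intro R hR
    obtain ⟨h0, h1⟩ := (denom_mul_eq_iff R).mp hR
    ext1 n
    rw [PowerSeries.coeff_mk]
    induction n with
    | zero => rw [h0, pow_zero, one_mul]
    | succ n ih => rw [h1, ih]; ring

lemma mon_natCast (i j : ℕ) : mon i j = mon 1 0 ^ i * mon 0 1 ^ j := by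
  simp [mon, AddMonoidAlgebra.single_pow, AddMonoidAlgebra.single_mul_single]

/-- The expansion of `numer / (x⁵ y⁴)` into monomials. -/
lemma mon_mul_numer :
    mon (-5) (-4) * numer = mon 0 0 - mon 1 (-2) + 2 * mon 0 (-4) - 2 * mon (-3) 2
      + 2 * mon (-5) 2 + 3 * mon (-4) 0 - 3 * mon (-3) (-2) - 2 * mon (-2) (-4) := by
  have h : numer = mon 5 4 - mon 6 2 + 2 * mon 5 0 - 2 * mon 2 6 + 2 * mon 0 6 + 3 * mon 1 4
      - 3 * mon 2 2 - 2 * mon 3 0 := by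
    have e1 := mon_natCast 3 0
    have e2 := mon_natCast 0 2
    have e3 := mon_natCast 2 2
    have e4 := mon_natCast 5 4
    have e5 := mon_natCast 6 2
    have e6 := mon_natCast 5 0
    have e7 := mon_natCast 2 6
    have e8 := mon_natCast 0 6
    have e9 := mon_natCast 1 4
    push_cast at e1 e2 e3 e4 e5 e6 e7 e8 e9
    rw [numer, e1, e2, e3, e4, e5, e6, e7, e8, e9]
    ring
  rw [h]
  simp only [mul_add, mul_sub, mul_left_comm (mon (-5) (-4)), mon_mul_mon]
  norm_num

lemma coeff_natCast_mul (k : ℕ) (F : Laurent) (e : ℤ × ℤ) :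
    ((k : Laurent) * F).coeff e = k * F.coeff e := by
  rw [← nsmul_eq_mul, ← nsmul_eq_mul, AddMonoidAlgebra.coeff_smul, Finsupp.smul_apply]

lemma coeff_mon_mul_numer (i j : ℤ) : (mon (-5) (-4) * numer).coeff (i, j) = closedForm i j 0 := by
  have h2 := coeff_natCast_mul 2
  have h3 := coeff_natCast_mul 3
  push_cast at h2 h3
  rw [mon_mul_numer]
  simp only [AddMonoidAlgebra.coeff_add, AddMonoidAlgebra.coeff_sub, Finsupp.add_apply,
    Finsupp.sub_apply, h2, h3, coeff_mon]
  by_cases hd : 4 ∣ ((0 : ℕ) : ℤ) - 2 * i - j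
  · obtain ⟨m, hm⟩ := hd
    push_cast at hm
    -- In the coordinates `(m, l)` the factorial arguments are `m`, `2 - m`, `l + 1`, `2 - l`, so
    -- the support lies in a box of twelve points. The polynomial factor kills four, leaving the
    -- eight monomials.
    obtain ⟨l, rfl⟩ : ∃ l, i = l - 2 * m := ⟨i + 2 * m, by ring⟩
    obtain rfl : j = -2 * l := by omega
    rw [closedForm_of_eq (m := m) (by push_cast; ring),
      show 3 * m + 2 * (l - 2 * m) + -2 * l + 2 = 2 - m by ring,
      show 2 * m + (l - 2 * m) + 1 = l + 1 by ring,
      show 2 * m + (l - 2 * m) + -2 * l + 2 = 2 - l by ring]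
    by_cases hr : 0 ≤ m ∧ m ≤ 2 ∧ -1 ≤ l ∧ l ≤ 2
    · obtain ⟨hm0, hm2, hl0, hl2⟩ := hr
      have f3 : invFactorial 3 = 6⁻¹ := invFactorial_natCast 3
      have f2 : invFactorial 2 = 2⁻¹ := invFactorial_natCast 2
      have f1 : invFactorial 1 = 1 := by simpa using invFactorial_natCast 1
      have f0 : invFactorial 0 = 1 := by simpa using invFactorial_natCast 0
      clear hm h2 h3
      interval_cases m <;> interval_cases l <;> norm_num [f0, f1, f2, f3]
    · have hz : invFactorial m * invFactorial (2 - m) * invFactorial (l + 1) *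
          invFactorial (2 - l) = 0 := by
        rcases (by omega : m < 0 ∨ 2 - m < 0 ∨ l + 1 < 0 ∨ 2 - l < 0) with h | h | h | h <;>
          rw [invFactorial_of_neg h] <;> ring
      rw [hz]
      repeat rw [if_neg (by omega)]
      norm_num
  · rw [closedForm_of_not_dvd hd]
    push_cast at hd
    repeat rw [if_neg (by omega)]
    norm_num

lemma coeff_quotient {R : PowerSeries Laurent} (hR : denom * R = PowerSeries.C numer)
    (n : ℕ) (i j : ℤ) : (PowerSeries.coeff n R).coeff (i, j) = closedForm i j n := by
  obtain ⟨h0, h1⟩ := (denom_mul_eq_iff R).mp hR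
  induction n generalizing i j with
  | zero => rw [h0, coeff_mon_mul_numer]
  | succ n ih =>
    rw [h1, stepLaurent, closedForm_succ]
    simp only [add_mul, AddMonoidAlgebra.coeff_add, Finsupp.add_apply, coeff_mon_mul, ih,
      sub_neg_eq_add, sub_zero]

lemma Q_eq_nonnegPart {R : PowerSeries Laurent} (hR : denom * R = PowerSeries.C numer) :
    Q steps = nonnegPart R := by
  ext n ⟨i, j⟩
  rw [Q, nonnegPart, PowerSeries.coeff_mk, PowerSeries.coeff_mk]
  simp only [Finsupp.onFinset_apply, Finsupp.filter_apply]
  split_ifs with h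
  · rw [coeff_quotient hR, q_steps_eq_closedForm n (by linarith [h.1]) (by linarith [h.2])]
  · rw [q_of_neg n h, Nat.cast_zero]

/-! ### Critical point and excursion exponent. -/

lemma stepPoly_steps (x y : ℝ) :
    stepPoly steps x y = y + x * y⁻¹ + x⁻¹ * y⁻¹ + (x ^ 2)⁻¹ * y := by
  rw [stepPoly, steps, Finset.sum_insert (by decide), Finset.sum_insert (by decide),
    Finset.sum_insert (by decide), Finset.sum_singleton]
  simp [zpow_neg, add_assoc]

lemma hasDerivAt_inv_pow (k : ℕ) {x : ℝ} (hx : x ≠ 0) :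
    HasDerivAt (fun x : ℝ => (x ^ (k + 1))⁻¹) (-((k : ℝ) + 1) * (x ^ (k + 2))⁻¹) x := by
  refine ((hasDerivAt_pow (k + 1) x).inv (pow_ne_zero _ hx)).congr_deriv ?_
  rw [Nat.add_sub_cancel]
  push_cast
  field_simp
  ring

lemma hasDerivAt_stepPoly_fst {x : ℝ} (y : ℝ) (hx : x ≠ 0) :
    HasDerivAt (fun x => stepPoly steps x y) (y⁻¹ - (x ^ 2)⁻¹ * y⁻¹ - 2 * (x ^ 3)⁻¹ * y) x := by
  have h1 : HasDerivAt (fun x : ℝ => x⁻¹) (-(x ^ 2)⁻¹) x := hasDerivAt_inv hx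
  have h2 : HasDerivAt (fun x : ℝ => (x ^ 2)⁻¹) (-2 * (x ^ 3)⁻¹) x := by
    simpa [one_add_one_eq_two] using hasDerivAt_inv_pow 1 hx
  have h := ((((hasDerivAt_id x).mul_const y⁻¹).const_add y).add (h1.mul_const y⁻¹)).add
    (h2.mul_const y)
  refine (h.congr_deriv ?_).congr_of_eventuallyEq (.of_forall fun z => ?_)
  · field_simp
    ring
  · exact stepPoly_steps _ _

lemma hasDerivAt_stepPoly_snd (x : ℝ) {y : ℝ} (hy : y ≠ 0) :
    HasDerivAt (fun y => stepPoly steps x y)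
      (1 + (x ^ 2)⁻¹ - (x + x⁻¹) * (y ^ 2)⁻¹) y := by
  have h1 : HasDerivAt (fun x : ℝ => x⁻¹) (-(y ^ 2)⁻¹) y := hasDerivAt_inv hy
  have h := (((hasDerivAt_id y).add (h1.const_mul x)).add (h1.const_mul x⁻¹)).add
    ((hasDerivAt_id y).const_mul (x ^ 2)⁻¹)
  refine (h.congr_deriv ?_).congr_of_eventuallyEq (.of_forall fun z => ?_)
  · ring
  · exact stepPoly_steps _ _

lemma dxx_steps {x : ℝ} (y : ℝ) (hx : x ≠ 0) :
    dxx steps x y = 2 * (x ^ 3)⁻¹ * y⁻¹ + 6 * (x ^ 4)⁻¹ * y := by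
  have hev : deriv (fun x => stepPoly steps x y) =ᶠ[nhds x]
      fun x => y⁻¹ - (x ^ 2)⁻¹ * y⁻¹ - 2 * (x ^ 3)⁻¹ * y := by
    filter_upwards [isOpen_ne.mem_nhds hx] with z hz
    exact (hasDerivAt_stepPoly_fst y hz).deriv
  have h2 : HasDerivAt (fun x : ℝ => (x ^ 2)⁻¹) (-2 * (x ^ 3)⁻¹) x := by
    simpa [one_add_one_eq_two] using hasDerivAt_inv_pow 1 hx
  have h3 : HasDerivAt (fun x : ℝ => (x ^ 3)⁻¹) (-3 * (x ^ 4)⁻¹) x := by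
    have := hasDerivAt_inv_pow 2 hx
    norm_num at this ⊢
    exact this
  have h := ((h2.mul_const y⁻¹).const_sub y⁻¹).sub ((h3.const_mul 2).mul_const y)
  rw [dxx, hev.deriv_eq]
  refine (h.congr_deriv ?_).deriv
  field_simp
  ring

lemma dyy_steps (x : ℝ) {y : ℝ} (hy : y ≠ 0) :
    dyy steps x y = 2 * (x + x⁻¹) * (y ^ 3)⁻¹ := by
  have hev : deriv (fun y => stepPoly steps x y) =ᶠ[nhds y]
      fun y => 1 + (x ^ 2)⁻¹ - (x + x⁻¹) * (y ^ 2)⁻¹ := by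
    filter_upwards [isOpen_ne.mem_nhds hy] with z hz
    exact (hasDerivAt_stepPoly_snd x hz).deriv
  have h2 : HasDerivAt (fun x : ℝ => (x ^ 2)⁻¹) (-2 * (y ^ 3)⁻¹) y := by
    simpa [one_add_one_eq_two] using hasDerivAt_inv_pow 1 hy
  have h := (h2.const_mul (x + x⁻¹)).const_sub (1 + (x ^ 2)⁻¹)
  rw [dyy, hev.deriv_eq]
  refine (h.congr_deriv ?_).deriv
  field_simp

lemma dxy_steps {x y : ℝ} (hx : x ≠ 0) (hy : y ≠ 0) :
    dxy steps x y = -(y ^ 2)⁻¹ + (x ^ 2)⁻¹ * (y ^ 2)⁻¹ - 2 * (x ^ 3)⁻¹ := by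
  have hf : (fun y => deriv (fun x => stepPoly steps x y) x) =
      fun y => y⁻¹ - (x ^ 2)⁻¹ * y⁻¹ - 2 * (x ^ 3)⁻¹ * y := by
    ext z
    exact (hasDerivAt_stepPoly_fst z hx).deriv
  have h1 : HasDerivAt (fun x : ℝ => x⁻¹) (-(y ^ 2)⁻¹) y := hasDerivAt_inv hy
  have h := (h1.sub (h1.const_mul (x ^ 2)⁻¹)).sub ((hasDerivAt_id y).const_mul (2 * (x ^ 3)⁻¹))
  rw [dxy, hf]
  refine (h.congr_deriv ?_).deriv
  ring

/-- `S_y` is a positive multiple of `(a² + 1)(b² - a)`, which forces `a = b²`; then `S_x = (b⁴ -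
3)/b⁵`. -/
lemma isPosCritical_steps_iff (a b : ℝ) :
    IsPosCritical steps a b ↔ 0 < b ∧ a = b ^ 2 ∧ b ^ 4 = 3 := by
  constructor
  · rintro ⟨ha, hb, h1, h2⟩
    rw [(hasDerivAt_stepPoly_fst b ha.ne').deriv] at h1
    rw [(hasDerivAt_stepPoly_snd a hb.ne').deriv] at h2
    have h2' : (a ^ 2 + 1) * (b ^ 2 - a) = 0 := by
      field_simp at h2
      linear_combination h2
    have hab : a = b ^ 2 := by
      rcases mul_eq_zero.mp h2' with h | h
      · nlinarith [sq_nonneg a]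
      · linarith
    refine ⟨hb, hab, ?_⟩
    subst hab
    field_simp at h1
    linear_combination h1
  · rintro ⟨hb, rfl, h⟩
    refine ⟨by positivity, hb, ?_, ?_⟩
    · rw [(hasDerivAt_stepPoly_fst b (by positivity)).deriv]
      field_simp
      linear_combination h
    · rw [(hasDerivAt_stepPoly_snd _ hb.ne').deriv]
      field_simp
      ring

lemma eq_of_pow_four_eq {b b' : ℝ} (hb : 0 < b) (hb' : 0 < b') (h : b ^ 4 = 3)
    (h' : b' ^ 4 = 3) : b = b' :=
  (pow_left_inj₀ hb.le hb'.le (by norm_num)).mp (h.trans h'.symm)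

lemma critical_point_data {b : ℝ} (hb : 0 < b) (h : b ^ 4 = 3) :
    dxx steps (b ^ 2) b = 8 / 3 / b ^ 3 ∧ dyy steps (b ^ 2) b = 8 / 3 / b ∧
      dxy steps (b ^ 2) b = -(4 / 3) / b ^ 2 ∧ stepPoly steps (b ^ 2) b = 8 / 3 * b := by
  have hb2 : b ^ 2 ≠ 0 := by positivity
  rw [dxx_steps _ hb2, dyy_steps _ hb.ne', dxy_steps hb2 hb.ne', stepPoly_steps]
  refine ⟨?_, ?_, ?_, ?_⟩ <;> field_simp
  · linear_combination (-8 : ℝ) * h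
  · linear_combination (-2 : ℝ) * h
  · linear_combination h
  · linear_combination (-2 : ℝ) * h

/-- Here `c = -1/2`, so the arccosine is `π/3`. -/
lemma excursion_exponent_eq {b : ℝ} (hb : 0 < b) (h : b ^ 4 = 3) :
    (-4 : ℝ) = -1 - Real.pi / Real.arccos (-(dxy steps (b ^ 2) b /
      √(dxx steps (b ^ 2) b * dyy steps (b ^ 2) b))) := by
  obtain ⟨h1, h2, h3, -⟩ := critical_point_data hb h
  have hs : 8 / 3 / b ^ 3 * (8 / 3 / b) = (8 / 3 / b ^ 2) ^ 2 := by
    field_simp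
  have hc : -(-(4 / 3) / b ^ 2 / (8 / 3 / b ^ 2)) = Real.cos (Real.pi / 3) := by
    rw [Real.cos_pi_div_three]
    field_simp
    norm_num
  rw [h1, h2, h3, hs, Real.sqrt_sq (by positivity), hc,
    Real.arccos_cos (by positivity) (by linarith [Real.pi_pos])]
  field_simp
  norm_num

/-! ### Stirling asymptotics for a fixed endpoint. -/

lemma tendsto_mul_natCast_add_div (a c : ℕ) :
    Tendsto (fun m : ℕ => ((a : ℝ) * m + c) / m) atTop (nhds a) := by
  have h : Tendsto (fun m : ℕ => (a : ℝ) + c / (m : ℝ)) atTop (nhds ((a : ℝ) + 0)) :=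
    tendsto_const_nhds.add (tendsto_const_div_atTop_nhds_zero_nat _)
  rw [add_zero] at h
  refine h.congr' ?_
  filter_upwards [eventually_gt_atTop 0] with m hm
  field_simp

lemma tendsto_factorial_add_div (a c : ℕ) :
    Tendsto (fun m : ℕ => ((a * m + c).factorial : ℝ) / ((a * m).factorial * (m : ℝ) ^ c)) atTop
      (nhds ((a : ℝ) ^ c)) := by
  induction c with
  | zero =>
    refine (tendsto_const_nhds (x := (1 : ℝ))).congr' ?_ |>.trans (by simp)
    refine .of_forall fun m => ?_
    have : ((a * m).factorial : ℝ) ≠ 0 := by positivity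
    simp [this]
  | succ c ih =>
    have h := ih.mul (tendsto_mul_natCast_add_div a (c + 1))
    rw [← pow_succ] at h
    refine h.congr fun m => ?_
    rw [← add_assoc, Nat.factorial_succ]
    push_cast
    rw [div_mul_div_comm]
    ring

lemma tendsto_factorial_div_stirling {a : ℕ} (ha : 0 < a) :
    Tendsto (fun m : ℕ => ((a * m).factorial : ℝ) /
      (√(2 * (a * m) * Real.pi) * ((a * m) / Real.exp 1) ^ (a * m))) atTop (nhds 1) := by
  have h0 : ∀ᶠ n : ℕ in atTop, √(2 * (n : ℝ) * Real.pi) * (n / Real.exp 1) ^ n ≠ 0 := by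
    filter_upwards [eventually_gt_atTop 0] with n hn
    positivity
  have h := (isEquivalent_iff_tendsto_one h0).mp Stirling.factorial_isEquivalent_stirling
  have hlim : Tendsto (fun m : ℕ => a * m) atTop atTop := tendsto_id.const_mul_atTop' ha
  refine (h.comp hlim).congr fun m => ?_
  simp only [Function.comp_apply, Pi.div_apply, Nat.cast_mul]

lemma tendsto_factorial_quotient :
    Tendsto (fun m : ℕ => ((4 * m).factorial : ℝ) ^ 2 /
        (m.factorial * (3 * m).factorial * (2 * m).factorial ^ 2) * m / (4096 / 27) ^ m) atTop
      (nhds (2 / (√12 * Real.pi))) := by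
  have h1 := tendsto_factorial_div_stirling (a := 1) (by norm_num)
  have h2 := tendsto_factorial_div_stirling (a := 2) (by norm_num)
  have h3 := tendsto_factorial_div_stirling (a := 3) (by norm_num)
  have h4 := tendsto_factorial_div_stirling (a := 4) (by norm_num)
  have h := ((h4.pow 2).div ((h1.mul h3).mul (h2.pow 2)) (by norm_num)).mul_const
    (2 / (√12 * Real.pi))
  norm_num only [one_mul, one_pow, div_one] at h
  refine h.congr' ?_
  filter_upwards [eventually_gt_atTop 0] with m hm
  have hm' : (0 : ℝ) < m := by exact_mod_cast hm
  have s4 : √(2 * (4 * m) * Real.pi) ^ 2 = 8 * m * Real.pi := by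
    rw [Real.sq_sqrt (by positivity)]; ring
  have s2 : √(2 * (2 * m) * Real.pi) ^ 2 = 4 * m * Real.pi := by
    rw [Real.sq_sqrt (by positivity)]; ring
  have s13 : √(2 * m * Real.pi) * √(2 * (3 * m) * Real.pi) = √12 * (m * Real.pi) := by
    rw [← Real.sqrt_mul (by positivity),
      show 2 * (m : ℝ) * Real.pi * (2 * (3 * m) * Real.pi) = 12 * (m * Real.pi) ^ 2 by ring,
      Real.sqrt_mul (by norm_num), Real.sqrt_sq (by positivity)]
  have hp : (((4 : ℝ) * m / Real.exp 1) ^ (4 * m)) ^ 2 = (4096 / 27) ^ m *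
      ((m / Real.exp 1) ^ m * (3 * m / Real.exp 1) ^ (3 * m) *
        ((2 * m / Real.exp 1) ^ (2 * m)) ^ 2) := by
    -- The powers of `z` cancel since `8m = m + 3m + 4m`; what is left is `4⁸ / (3³ · 2⁴) =
    -- 4096/27`.
    generalize hz : (m : ℝ) / Real.exp 1 = z
    simp only [mul_div_assoc, hz]
    have e1 : ((4 * z) ^ (4 * m)) ^ 2 = ((4 * z) ^ 8) ^ m := by
      rw [← pow_mul, ← pow_mul]; congr 1; ring
    have e2 : ((2 * z) ^ (2 * m)) ^ 2 = ((2 * z) ^ 4) ^ m := by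
      rw [← pow_mul, ← pow_mul]; congr 1; ring
    rw [e1, e2, pow_mul (3 * z), ← mul_pow, ← mul_pow, ← mul_pow]
    congr 1
    ring
  have hL : ∀ F1 F2 F3 F4 s1 s2 s3 s4 p1 p2 p3 p4 : ℝ,
      (F4 / (s4 * p4)) ^ 2 / (F1 / (s1 * p1) * (F3 / (s3 * p3)) * (F2 / (s2 * p2)) ^ 2) =
      F4 ^ 2 / (F1 * F3 * F2 ^ 2) * ((s1 * s3) * s2 ^ 2 * (p1 * p3 * p2 ^ 2)) /
        (s4 ^ 2 * p4 ^ 2) := by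
    intros
    simp only [div_eq_mul_inv, mul_inv, inv_inv, mul_pow, inv_pow]
    ring
  simp only [Pi.div_apply]
  rw [hL, s4, s2, s13, hp]
  field_simp
  ring

/-- Removing the shifts from the five factorials leaves `m^(2e+2) / m^(2e+5)` with `e = 2i + j`, and
the unshifted quotient contributes another `1/m`: hence `n⁻⁴`. The growth rate matches because
`(8b/3)⁴ = 4096/27`. -/
lemma tendsto_q_steps {b : ℝ} (hb : 0 < b) (h : b ^ 4 = 3) (i j : ℕ) :
    ∃ κ : ℝ, 0 < κ ∧ Tendsto (fun m : ℕ =>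
      (q steps (i, j) (4 * m + (2 * i + j)) : ℝ) * ((4 * m + (2 * i + j) : ℕ) : ℝ) ^ 4 /
        (8 / 3 * b) ^ (4 * m + (2 * i + j))) atTop (nhds κ) := by
  obtain ⟨e, he⟩ : ∃ e, e = 2 * i + j := ⟨_, rfl⟩
  rw [← he]
  have t1 := tendsto_factorial_add_div 4 e
  have t2 := tendsto_factorial_add_div 4 (e + 2)
  have t3 := tendsto_factorial_add_div 3 (e + 2)
  have t4 := tendsto_factorial_add_div 2 (i + 1)
  have t5 := tendsto_factorial_add_div 2 (i + j + 2)
  have t6 := (tendsto_mul_natCast_add_div 4 e).pow 4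
  have t := ((((t1.mul t2).div ((t3.mul t4).mul t5) (by positivity)).mul
    tendsto_factorial_quotient).mul t6).mul_const
      (((i + 1) * (j + 1) * (i + j + 2) : ℝ) / (8 / 3 * b) ^ e)
  refine ⟨_, ?_, t.congr' ?_⟩
  · have := Real.pi_pos
    positivity
  · filter_upwards [eventually_gt_atTop 0] with m hm
    have hq := q_steps_eq (i := i) (j := j) (m := m) (n := 4 * m + e) (by omega)
    have hq' := congrArg (Rat.cast : ℚ → ℝ) hq
    push_cast at hq'
    rw [hq', show 3 * m + 2 * i + j + 2 = 3 * m + (e + 2) by omega,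
      show 2 * m + i + j + 2 = 2 * m + (i + j + 2) by omega,
      show 2 * m + i + 1 = 2 * m + (i + 1) by omega,
      show 4 * m + e + 2 = 4 * m + (e + 2) by omega]
    have hμ : (8 / 3 * b) ^ (4 * m + e) = (4096 / 27) ^ m * (8 / 3 * b) ^ e := by
      rw [pow_add, pow_mul, mul_pow, h]
      norm_num
    rw [hμ]
    have hm' : (m : ℝ) ≠ 0 := by positivity
    have hpow : (m : ℝ) ^ (i + 1) * (m : ℝ) ^ (i + j + 2) = m ^ e * m ^ 3 := by
      rw [← pow_add, ← pow_add, he]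
      congr 1
      ring
    push_cast
    simp only [Pi.div_apply]
    have p1 : ((4 * m).factorial : ℝ) ≠ 0 := by positivity
    have p2 : ((3 * m).factorial : ℝ) ≠ 0 := by positivity
    have p3 : ((2 * m).factorial : ℝ) ≠ 0 := by positivity
    have hL : ∀ f1 f2 f3 f4 f5 F1 F2 F3 F4 x y X1 X2 N P k v : ℝ,
        F2 ≠ 0 → F3 ≠ 0 → F4 ≠ 0 → f3 ≠ 0 → f4 ≠ 0 → f5 ≠ 0 → F1 ≠ 0 → k ≠ 0 → v ≠ 0 → x ≠ 0 → y ≠ 0 → X1 ≠ 0 → X2 ≠ 0 → X1 * X2 = y * x ^ 3 →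
        f1 / (F4 * y) * (f2 / (F4 * (y * x ^ 2))) / (f3 / (F3 * (y * x ^ 2)) * (f4 / (F2 * X1)) *
          (f5 / (F2 * X2))) * (F4 ^ 2 / (F1 * F3 * F2 ^ 2) * x / k) * (N / x) ^ 4 * (P / v) =
        P * f1 * f2 / (F1 * f3 * f4 * f5) * N ^ 4 / (k * v) := by
      intro f1 f2 f3 f4 f5 F1 F2 F3 F4 x y X1 X2 N P k v h2 h3 h4 _ _ _ _ _ _ hx hy h1 h2' hX
      have hX2 : X2 = y * x ^ 3 / X1 := by rw [eq_div_iff h1]; linear_combination hX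
      rw [hX2]
      field_simp
    rw [pow_add (m : ℝ) e 2]
    exact hL _ _ _ _ _ _ _ _ _ _ _ _ _ _ _ _ _ p3 p2 p1 (by positivity)
      (by positivity) (by positivity) (by positivity) (by positivity) (by positivity) hm'
      (by positivity) (by positivity) (by positivity) hpow

/-- Being equivalent to the zero function means eventual vanishing, so a zero limit alone would not
suffice; `hzero` supplies the rest. -/
lemma hasGrowth_of_tendsto {u : ℕ → ℕ} {μ : ℝ} (hμ : 0 < μ) {p : ℕ} (hp : 0 < p)
    (κ : Fin p → ℝ) (hκ : ∀ r, 0 ≤ κ r) (hpos : ∃ r, 0 < κ r)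
    (hzero : ∀ r : Fin p, κ r = 0 → ∀ m, u (p * m + r) = 0)
    (hlim : ∀ r : Fin p, Tendsto (fun m : ℕ => (u (p * m + r) : ℝ) * ((p * m + r : ℕ) : ℝ) ^ 4 /
      μ ^ (p * m + r : ℕ)) atTop (nhds (κ r))) : HasGrowth u μ (-4) := by
  refine ⟨hμ, p, hp, κ, hκ, hpos, fun r => ?_⟩
  rcases (hκ r).eq_or_lt with h0 | h0
  · simp only [hzero r h0.symm, ← h0, zero_mul, Nat.cast_zero]
    exact IsEquivalent.refl
  · have hn : ∀ᶠ m : ℕ in atTop, 0 < ((p * m + r : ℕ) : ℝ) := by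
      filter_upwards [eventually_gt_atTop 0] with m hm
      have := Nat.mul_pos hp hm
      exact_mod_cast (by omega : 0 < p * m + r)
    refine (isEquivalent_iff_tendsto_one ?_).mpr ?_
    · filter_upwards [hn] with m hm
      positivity
    · have h := (hlim r).div_const (κ r)
      rw [div_self h0.ne'] at h
      refine h.congr' ?_
      filter_upwards [hn] with m hm
      have hr : ((p * m + r : ℕ) : ℝ) ^ (-4 : ℝ) = (((p * m + r : ℕ) : ℝ) ^ 4)⁻¹ := by
        rw [Real.rpow_neg hm.le]
        norm_cast
      simp only [Pi.div_apply, hr]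
      field_simp

/-! ### Uniform bounds of order `1/√N` for binomial terms. -/

/-- The terms `(N choose k) c ^ (N - k)` of the binomial expansion of `(1 + c) ^ N`. -/
def binomTerm (c N k : ℕ) : ℕ := N.choose k * c ^ (N - k)

lemma binomTerm_succ_le {c N X : ℕ} (h : ∀ k, binomTerm c N k ≤ X) (k : ℕ) :
    binomTerm c (N + 1) k ≤ (c + 1) * X := by
  cases k with
  | zero =>
    have := h 0
    simp only [binomTerm, Nat.choose_zero_right, one_mul, Nat.sub_zero] at this ⊢
    rw [pow_succ]
    nlinarith
  | succ k =>
    have h1 := h k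
    have h2 := h (k + 1)
    simp only [binomTerm] at h1 h2 ⊢
    rw [Nat.choose_succ_succ, Nat.add_sub_add_right, add_mul]
    rcases Nat.lt_or_ge k N with hk | hk
    · rw [show N - k = N - (k + 1) + 1 by omega] at h1 ⊢
      rw [pow_succ] at h1 ⊢
      nlinarith
    · rw [Nat.choose_eq_zero_of_lt (show N < k + 1 by omega)]
      nlinarith

lemma binomTerm_succ_mul (c N k : ℕ) :
    binomTerm c N (k + 1) * ((k + 1) * c) = binomTerm c N k * (N - k) := by
  have h := Nat.choose_succ_right_eq N k
  rcases Nat.lt_or_ge k N with hk | hk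
  · rw [binomTerm, binomTerm, show N - k = N - (k + 1) + 1 by omega, pow_succ]
    rw [show N - k = N - (k + 1) + 1 by omega] at h
    linear_combination (c ^ (N - (k + 1)) * c) * h
  · rw [binomTerm, Nat.choose_eq_zero_of_lt (show N < k + 1 by omega), Nat.sub_eq_zero_of_le hk]
    ring

/-- The ratio of consecutive terms, `(N - k) / ((k + 1) c)`, is at least one before `k = M` and at
most one from there on. -/
lemma binomTerm_le_peak {c : ℕ} (hc : 0 < c) (M k : ℕ) :
    binomTerm c ((c + 1) * M) k ≤ binomTerm c ((c + 1) * M) M := by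
  rcases le_total k M with hk | hk
  · induction hk using Nat.decreasingInduction with
    | self => exact le_rfl
    | of_succ k hk ih =>
      refine le_trans ?_ ih
      have h := binomTerm_succ_mul c ((c + 1) * M) k
      have hle : (k + 1) * c ≤ (c + 1) * M - k := by
        refine Nat.le_sub_of_add_le ?_
        nlinarith
      refine Nat.le_of_mul_le_mul_right ?_ (show 0 < (k + 1) * c by positivity)
      rw [h]
      exact Nat.mul_le_mul_left _ hle
  · induction k, hk using Nat.le_induction with
    | base => exact le_rfl
    | succ k hk ih =>
      refine le_trans ?_ ih
      have h := binomTerm_succ_mul c ((c + 1) * M) k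
      have hle : (c + 1) * M - k ≤ (k + 1) * c := by
        refine Nat.sub_le_of_le_add ?_
        nlinarith
      refine Nat.le_of_mul_le_mul_right ?_ (show 0 < (k + 1) * c by positivity)
      rw [h]
      exact Nat.mul_le_mul_left _ hle

lemma binomTerm_add_le {c : ℕ} (hc : 0 < c) (M r k : ℕ) :
    binomTerm c ((c + 1) * M + r) k ≤ (c + 1) ^ r * binomTerm c ((c + 1) * M) M := by
  induction r generalizing k with
  | zero => simpa using binomTerm_le_peak hc M k
  | succ r ih =>
    rw [← add_assoc, pow_succ', mul_assoc]
    exact binomTerm_succ_le ih k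

/-- Passing from a multiple of `c + 1` to a general `N` costs one factor `c + 1` per unit, exactly
the growth of the full sum `(c+1)^N`. Squares avoid square roots in `ℕ`. -/
lemma binomTerm_sq_mul_le {c : ℕ} (hc : 0 < c)
    (hpeak : ∀ M, binomTerm c ((c + 1) * M) M ^ 2 * (M + 1) ≤ ((c + 1) ^ ((c + 1) * M)) ^ 2)
    (N k : ℕ) : binomTerm c N k ^ 2 * N ≤ (c + 1) * ((c + 1) ^ N) ^ 2 := by
  have hN := Nat.div_add_mod N (c + 1)
  have hr := Nat.mod_lt N (Nat.succ_pos c)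
  set M := N / (c + 1)
  set r := N % (c + 1)
  have h1 := binomTerm_add_le hc M r k
  rw [hN] at h1
  calc binomTerm c N k ^ 2 * N
      ≤ ((c + 1) ^ r * binomTerm c ((c + 1) * M) M) ^ 2 * ((c + 1) * (M + 1)) := by
        gcongr
        nlinarith
    _ = (c + 1) * ((c + 1) ^ r) ^ 2 * (binomTerm c ((c + 1) * M) M ^ 2 * (M + 1)) := by ring
    _ ≤ (c + 1) * ((c + 1) ^ r) ^ 2 * ((c + 1) ^ ((c + 1) * M)) ^ 2 := by gcongr; exact hpeak M
    _ = (c + 1) * ((c + 1) ^ N) ^ 2 := by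
        rw [mul_assoc, ← mul_pow, ← pow_add, add_comm r, hN]

/-- The factor `M + 1` makes the induction close, by `(2M+1)²(M+2) ≤ 4(M+1)³`. -/
lemma binomTerm_one_peak (M : ℕ) :
    binomTerm 1 ((1 + 1) * M) M ^ 2 * (M + 1) ≤ ((1 + 1) ^ ((1 + 1) * M)) ^ 2 := by
  simp only [binomTerm, one_pow, mul_one, one_add_one_eq_two, ← Nat.centralBinom_eq_two_mul_choose]
  induction M with
  | zero => simp
  | succ M ih =>
    have h := Nat.succ_mul_centralBinom_succ M
    refine Nat.le_of_mul_le_mul_left ?_ (show 0 < (M + 1) ^ 3 by positivity)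
    calc (M + 1) ^ 3 * (Nat.centralBinom (M + 1) ^ 2 * (M + 1 + 1))
        = ((M + 1) * Nat.centralBinom (M + 1)) ^ 2 * ((M + 1) * (M + 2)) := by ring
      _ = (Nat.centralBinom M ^ 2 * (M + 1)) * (4 * (2 * M + 1) ^ 2 * (M + 2)) := by
          rw [h]; ring
      _ ≤ (2 ^ (2 * M)) ^ 2 * (16 * (M + 1) ^ 3) := by
          refine Nat.mul_le_mul ih ?_
          nlinarith
      _ = (M + 1) ^ 3 * (2 ^ (2 * (M + 1))) ^ 2 := by ring

lemma choose_four_mul_succ (M : ℕ) :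
    (4 * (M + 1)).choose (M + 1) * (3 * (M + 1) * (3 * M + 2) * (3 * M + 1)) =
      (4 * M).choose M * (8 * (4 * M + 3) * (2 * M + 1) * (4 * M + 1)) := by
  have h0 := Nat.choose_mul_factorial_mul_factorial (show M ≤ 4 * M by omega)
  have h1 := Nat.choose_mul_factorial_mul_factorial (show M + 1 ≤ 4 * (M + 1) by omega)
  rw [show 4 * M - M = 3 * M by omega] at h0
  rw [show 4 * (M + 1) - (M + 1) = 3 * M + 1 + 1 + 1 by omega,
    show (4 * (M + 1)).factorial = (4 * M + 1 + 1 + 1 + 1).factorial by congr 1,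
    Nat.factorial_succ M] at h1
  simp only [Nat.factorial_succ (_ + 1), Nat.factorial_succ (3 * M), Nat.factorial_succ (4 * M)]
    at h1
  rw [← h0] at h1
  refine Nat.eq_of_mul_eq_mul_right
    (show 0 < (M + 1) * M.factorial * (3 * M).factorial by positivity) ?_
  linear_combination h1

lemma binomTerm_three_peak (M : ℕ) :
    binomTerm 3 ((3 + 1) * M) M ^ 2 * (M + 1) ≤ ((3 + 1) ^ ((3 + 1) * M)) ^ 2 := by
  have e : ∀ M, binomTerm 3 ((3 + 1) * M) M = (4 * M).choose M * 27 ^ M := by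
    intro M
    rw [binomTerm, show (3 + 1) * M - M = 3 * M by omega, pow_mul]
    norm_num only
  rw [e]
  norm_num only
  induction M with
  | zero => simp
  | succ M ih =>
    have h := choose_four_mul_succ M
    set A := (4 * (M + 1)).choose (M + 1)
    set B := (4 * M).choose M
    refine Nat.le_of_mul_le_mul_left ?_
      (show 0 < (3 * (M + 1) * (3 * M + 2) * (3 * M + 1)) ^ 2 * (M + 1) by positivity)
    have key : 27 ^ 2 * (8 * (4 * M + 3) * (2 * M + 1) * (4 * M + 1)) ^ 2 * (M + 2) ≤
        256 ^ 2 * ((3 * (M + 1) * (3 * M + 2) * (3 * M + 1)) ^ 2 * (M + 1)) := by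
      zify
      have hM : (0 : ℤ) ≤ M := by positivity
      rw [← sub_nonneg]
      ring_nf
      positivity
    calc (3 * (M + 1) * (3 * M + 2) * (3 * M + 1)) ^ 2 * (M + 1) *
          ((A * 27 ^ (M + 1)) ^ 2 * (M + 1 + 1))
        = (A * (3 * (M + 1) * (3 * M + 2) * (3 * M + 1))) ^ 2 * (M + 1) *
          ((27 ^ (M + 1)) ^ 2 * (M + 2)) := by ring
      _ = ((B * 27 ^ M) ^ 2 * (M + 1)) *
          (27 ^ 2 * (8 * (4 * M + 3) * (2 * M + 1) * (4 * M + 1)) ^ 2 * (M + 2)) := by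
          rw [h]; ring
      _ ≤ (4 ^ (4 * M)) ^ 2 *
          (256 ^ 2 * ((3 * (M + 1) * (3 * M + 2) * (3 * M + 1)) ^ 2 * (M + 1))) :=
          Nat.mul_le_mul ih key
      _ = (3 * (M + 1) * (3 * M + 2) * (3 * M + 1)) ^ 2 * (M + 1) *
          (4 ^ (4 * (M + 1))) ^ 2 := by
          rw [show 4 ^ (4 * (M + 1)) = 4 ^ (4 * M) * 256 by rw [mul_add, pow_add]; norm_num]
          ring

lemma choose_mul_choose_le (n k l : ℕ) :
    ((n + 2).choose k : ℝ) * 3 ^ (n + 2 - k) * (n + 3).choose l * (n + 2) ≤ 384 * 8 ^ n := by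
  have h1 := binomTerm_sq_mul_le (by norm_num) binomTerm_three_peak (n + 2) k
  have h2 := binomTerm_sq_mul_le (by norm_num) binomTerm_one_peak (n + 3) l
  simp only [binomTerm, one_pow, mul_one] at h1 h2
  have h1' : (((n + 2).choose k : ℝ) * 3 ^ (n + 2 - k)) ^ 2 * (n + 2) ≤ 4 * (4 ^ (n + 2)) ^ 2 := by
    exact_mod_cast h1
  have h2' : ((n + 3).choose l : ℝ) ^ 2 * (n + 3) ≤ 2 * (2 ^ (n + 3)) ^ 2 := by
    exact_mod_cast h2
  set A := ((n + 2).choose k : ℝ) * 3 ^ (n + 2 - k)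
  set B := ((n + 3).choose l : ℝ)
  have hA : 0 ≤ A := by positivity
  have hB : 0 ≤ B := by positivity
  refine le_of_sq_le_sq ?_ (by positivity)
  calc (A * B * (n + 2)) ^ 2 = (A ^ 2 * (n + 2)) * (B ^ 2 * (n + 2)) := by ring
    _ ≤ (A ^ 2 * (n + 2)) * (B ^ 2 * (n + 3)) := by gcongr; norm_num
    _ ≤ (4 * (4 ^ (n + 2)) ^ 2) * (2 * (2 ^ (n + 3)) ^ 2) := by gcongr
    _ = 8 * (128 * (4 ^ n * 2 ^ n)) ^ 2 := by ring
    -- Rounding `8` up to a square yields the constant `384 = 3 · 128`.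
    _ ≤ 9 * (128 * (4 ^ n * 2 ^ n)) ^ 2 := by gcongr; norm_num
    _ = (384 * 8 ^ n) ^ 2 := by rw [← mul_pow]; norm_num; ring

/-- The four factorials in the denominator pair up: their arguments sum to `n + 2` and `n + 3`. -/
lemma q_steps_eq_choose {i j m n : ℕ} (h : n = 2 * i + j + 4 * m) :
    (q steps ((i : ℤ), (j : ℤ)) n : ℝ) = (i + 1) * (j + 1) * (i + j + 2) *
      ((n + 2).choose m * (n + 3).choose (2 * m + i + 1)) / ((n + 1) * (n + 2) * (n + 3)) := by
  have hq' := congrArg (Rat.cast : ℚ → ℝ) (q_steps_eq h)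
  push_cast at hq'
  have h0 := Nat.choose_mul_factorial_mul_factorial (show m ≤ n + 2 by omega)
  have h1 := Nat.choose_mul_factorial_mul_factorial (show 2 * m + i + 1 ≤ n + 3 by omega)
  rw [show n + 2 - m = 3 * m + 2 * i + j + 2 by omega] at h0
  rw [show n + 3 - (2 * m + i + 1) = 2 * m + i + j + 2 by omega] at h1
  have h0' := congrArg (Nat.cast : ℕ → ℝ) h0
  have h1' := congrArg (Nat.cast : ℕ → ℝ) h1
  rw [Nat.factorial_succ (n + 2), Nat.factorial_succ (n + 1), Nat.factorial_succ n] at h1'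
  push_cast at h0' h1'
  rw [hq', div_eq_div_iff (by positivity) (by positivity), ← h0']
  linear_combination (-((i + 1) * (j + 1) * (i + j + 2) : ℝ) * ((n + 2).choose m) *
    m.factorial * (3 * m + 2 * i + j + 2).factorial) * h1'

/-- Since `bⁿ = 3^m b^(2i+j)`, the weight `3^(n+2-m)` in the binomial bound is the one that absorbs
`3^m` and leaves geometric decay in the endpoint. -/
lemma q_steps_mul_le {b : ℝ} (hb : 0 < b) (h : b ^ 4 = 3) (i j n : ℕ) :
    (q steps ((i : ℤ), (j : ℤ)) n : ℝ) * (n : ℝ) ^ 4 / (8 / 3 * b) ^ n ≤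
      128 / 3 * ((i + 1) * (j + 1) * (i + j + 2)) * b⁻¹ ^ (2 * i + j) := by
  by_cases hm : ∃ m : ℕ, n = 2 * i + j + 4 * m
  · obtain ⟨m, hm⟩ := hm
    have hle := choose_mul_choose_le n m (2 * m + i + 1)
    have hn : (n : ℝ) ^ 4 ≤ (n + 1) * (n + 2) * (n + 3) * (n + 2) := by
      have : (0 : ℝ) ≤ n := by positivity
      rw [← sub_nonneg]
      ring_nf
      positivity
    have h3 : (3 : ℝ) ^ (n + 2 - m) * 3 ^ m = 9 * 3 ^ n := by
      rw [← pow_add, Nat.sub_add_cancel (by omega), pow_add]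
      norm_num
      ring
    have hbn : b ^ n = 3 ^ m * b ^ (2 * i + j) := by
      rw [← h, ← pow_mul, ← pow_add, hm, add_comm]
    rw [q_steps_eq_choose hm, mul_pow, div_pow, hbn]
    set P : ℝ := (i + 1) * (j + 1) * (i + j + 2)
    have hP : 0 ≤ P := by positivity
    set A : ℝ := (((n + 2).choose m : ℕ) : ℝ)
    set B : ℝ := (((n + 3).choose (2 * m + i + 1) : ℕ) : ℝ)
    have hA : 0 ≤ A := by positivity
    have hB : 0 ≤ B := by positivity
    have hAB : A * B * (n + 2) ≤ 128 / 3 * (8 ^ n / 3 ^ n) * 3 ^ m := by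
      have e : A * 3 ^ (n + 2 - m) * B * (n + 2) = A * B * (n + 2) * (9 * 3 ^ n) / 3 ^ m := by
        rw [← h3]
        field_simp
      rw [e, div_le_iff₀ (by positivity)] at hle
      have : A * B * (n + 2) ≤ 384 * 8 ^ n * 3 ^ m / (9 * 3 ^ n) := by
        rw [le_div_iff₀ (by positivity)]
        exact hle
      refine this.trans_eq ?_
      field_simp
      norm_num
    rw [inv_pow, div_le_iff₀ (by positivity)]
    calc P * (A * B) / ((n + 1) * (n + 2) * (n + 3)) * (n : ℝ) ^ 4
        ≤ P * (A * B) / ((n + 1) * (n + 2) * (n + 3)) *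
          ((n + 1) * (n + 2) * (n + 3) * (n + 2)) := by gcongr
      _ = P * (A * B * (n + 2)) := by field_simp
      _ ≤ P * (128 / 3 * (8 ^ n / 3 ^ n) * 3 ^ m) := by gcongr
      _ = _ := by field_simp
  · rw [q_steps_eq_zero hm, Nat.cast_zero, zero_mul, zero_div]
    positivity

lemma summable_bound {x : ℝ} (hx0 : 0 ≤ x) (hx1 : x < 1) :
    Summable fun p : ℕ × ℕ => 128 / 3 * (((p.1 : ℝ) + 1) * (p.2 + 1) * (p.1 + p.2 + 2)) *
      x ^ (2 * p.1 + p.2) := by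
  have key : ∀ y : ℝ, 0 ≤ y → y < 1 → Summable fun n : ℕ => ((n : ℝ) + 1) ^ 2 * y ^ n := by
    intro y hy0 hy1
    have hn : ‖y‖ < 1 := by rwa [Real.norm_of_nonneg hy0]
    have h2 := summable_pow_mul_geometric_of_norm_lt_one 2 hn
    have h1 := summable_pow_mul_geometric_of_norm_lt_one 1 hn
    have h0 := summable_pow_mul_geometric_of_norm_lt_one 0 hn
    refine ((h2.add (h1.mul_left 2)).add h0).congr fun n => ?_
    ring
  have h1 := key (x ^ 2) (by positivity) (by nlinarith)
  have h2 := key x hx0 hx1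
  have h := ((h1.mul_of_nonneg h2 (fun n => by positivity) (fun n => by positivity)).mul_left
    (256 / 3))
  refine Summable.of_nonneg_of_le (fun p => by positivity) (fun p => ?_) h
  have e : x ^ (2 * p.1 + p.2) = (x ^ 2) ^ p.1 * x ^ p.2 := by rw [pow_add, pow_mul]
  have hp : ((p.1 : ℝ) + p.2 + 2) ≤ 2 * ((p.1 + 1) * (p.2 + 1)) := by
    have a1 : (0 : ℝ) ≤ p.1 := by positivity
    have a2 : (0 : ℝ) ≤ p.2 := by positivity
    nlinarith [mul_nonneg a1 a2]
  calc 128 / 3 * (((p.1 : ℝ) + 1) * (p.2 + 1) * (p.1 + p.2 + 2)) * x ^ (2 * p.1 + p.2)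
      ≤ 128 / 3 * (((p.1 : ℝ) + 1) * (p.2 + 1) * (2 * ((p.1 + 1) * (p.2 + 1)))) *
        x ^ (2 * p.1 + p.2) := by gcongr
    _ = _ := by rw [e]; ring

/-! ### Summation over endpoints and the two exponents. -/

lemma total_steps_eq_sum (n : ℕ) :
    total steps n = ∑ p ∈ Finset.range (n + 1) ×ˢ Finset.range (n + 1),
      q steps ((p.1 : ℤ), (p.2 : ℤ)) n := by
  have hmem : ∀ w ∈ walks steps n, 0 ≤ (endpoint w).1 ∧ 0 ≤ (endpoint w).2 := fun w hw =>
    (Finset.mem_filter.mp hw).2 n le_rfl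
  have heq : ∀ w ∈ walks steps n, ∀ p : ℕ × ℕ,
      ((endpoint w).1.toNat, (endpoint w).2.toNat) = p ↔
        endpoint w = ((p.1 : ℤ), (p.2 : ℤ)) := by
    intro w hw p
    have := hmem w hw
    rw [Prod.ext_iff, Prod.ext_iff]
    simp only
    omega
  rw [total, Finset.card_eq_sum_card_fiberwise
    (f := fun w => ((endpoint w).1.toNat, (endpoint w).2.toNat))
    (t := Finset.range (n + 1) ×ˢ Finset.range (n + 1))]
  · refine Finset.sum_congr rfl fun p _ => ?_
    rw [q, Finset.filter_congr fun w hw => heq w hw p]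
  · intro w hw
    have hw' := (heq w hw _).mp rfl
    have hq : q steps (((endpoint w).1.toNat : ℤ), ((endpoint w).2.toNat : ℤ)) n ≠ 0 :=
      Finset.card_ne_zero_of_mem (Finset.mem_filter.mpr ⟨hw, hw'⟩)
    have hm := not_imp_comm.mp q_steps_eq_zero hq
    obtain ⟨m, hm⟩ := hm
    simp only [Finset.coe_product, Set.mem_prod, Finset.coe_range, Set.mem_Iio]
    omega

lemma total_steps_eq_tsum (n : ℕ) (c : ℝ) :
    (total steps n : ℝ) * c = ∑' p : ℕ × ℕ, (q steps ((p.1 : ℤ), (p.2 : ℤ)) n : ℝ) * c := by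
  rw [tsum_eq_sum (s := Finset.range (n + 1) ×ˢ Finset.range (n + 1)), total_steps_eq_sum]
  · push_cast
    rw [Finset.sum_mul]
  · intro p hp
    rw [q_steps_eq_zero, Nat.cast_zero, zero_mul]
    rintro ⟨m, hm⟩
    refine hp ?_
    rw [Finset.mem_product, Finset.mem_range, Finset.mem_range]
    omega

lemma tendsto_q_steps_residue {b : ℝ} (hb : 0 < b) (h : b ^ 4 = 3) (i j : ℕ) (r : Fin 4) :
    ∃ κ : ℝ, 0 ≤ κ ∧ ((2 * i + j) % 4 = r → 0 < κ) ∧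
      ((2 * i + j) % 4 ≠ r → ∀ m : ℕ, q steps ((i : ℤ), (j : ℤ)) (4 * m + r) = 0) ∧
      Tendsto (fun m : ℕ => (q steps (i, j) (4 * m + r) : ℝ) * ((4 * m + r : ℕ) : ℝ) ^ 4 /
        (8 / 3 * b) ^ (4 * m + r : ℕ)) atTop (nhds κ) := by
  by_cases hr : (2 * i + j) % 4 = r
  · obtain ⟨κ, hκ, hlim⟩ := tendsto_q_steps hb h i j
    refine ⟨κ, hκ.le, fun _ => hκ, fun h' => absurd hr h', ?_⟩
    rw [← tendsto_add_atTop_iff_nat ((2 * i + j) / 4)]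
    refine hlim.congr fun m => ?_
    rw [show 4 * (m + (2 * i + j) / 4) + (r : ℕ) = 4 * m + (2 * i + j) by omega]
  · have hz : ∀ m : ℕ, q steps ((i : ℤ), (j : ℤ)) (4 * m + r) = 0 := by
      intro m
      refine q_steps_eq_zero ?_
      rintro ⟨m', hm'⟩
      omega
    refine ⟨0, le_rfl, fun h' => absurd h' hr, fun _ => hz, ?_⟩
    simp [hz]

lemma hasGrowth_excursions {b : ℝ} (hb : 0 < b) (h : b ^ 4 = 3) :
    HasGrowth (q steps (0, 0)) (8 / 3 * b) (-4) := by
  choose κ h0 h1 h2 h4 using tendsto_q_steps_residue hb h 0 0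
  refine hasGrowth_of_tendsto (by positivity) (by norm_num : 0 < 4) κ h0 ⟨0, h1 0 rfl⟩ ?_ h4
  intro r hr
  refine h2 r fun hr' => ?_
  exact (h1 r hr').ne' hr

lemma hasGrowth_total {b : ℝ} (hb : 0 < b) (h : b ^ 4 = 3) :
    HasGrowth (total steps) (8 / 3 * b) (-4) := by
  have hb1 : b⁻¹ < 1 := by
    refine inv_lt_one_of_one_lt₀ ?_
    by_contra! hle
    have := pow_le_one₀ (n := 4) hb.le hle
    linarith
  have hsum := summable_bound (inv_nonneg.mpr hb.le) hb1
  have hlim : ∀ r : Fin 4, ∃ κ : ℝ, 0 < κ ∧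
      Tendsto (fun m : ℕ => (total steps (4 * m + r) : ℝ) * ((4 * m + r : ℕ) : ℝ) ^ 4 /
        (8 / 3 * b) ^ (4 * m + r : ℕ)) atTop (nhds κ) := by
    intro r
    choose κ h0 h1 _ h4 using fun p : ℕ × ℕ => tendsto_q_steps_residue hb h p.1 p.2 r
    have hκ : Summable κ := by
      refine hsum.of_nonneg_of_le h0 fun p => ?_
      exact le_of_tendsto (h4 p) (.of_forall fun m => q_steps_mul_le hb h p.1 p.2 _)
    -- The endpoint `(0, r)` lies in residue class `r`, so the limit is positive in every class.
    refine ⟨∑' p, κ p, hκ.tsum_pos h0 (0, r) (h1 (0, r) ?_), ?_⟩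
    · simp only
      omega
    · have ht := tendsto_tsum_of_dominated_convergence hsum h4 (.of_forall fun m p => by
        rw [Real.norm_of_nonneg (by positivity)]
        exact q_steps_mul_le hb h p.1 p.2 _)
      refine ht.congr fun m => ?_
      simp only [mul_div_assoc]
      rw [total_steps_eq_tsum]
  choose κ hκ hκlim using hlim
  exact hasGrowth_of_tendsto (by positivity) (by norm_num : 0 < 4) κ (fun r => (hκ r).le)
    ⟨0, hκ 0⟩ (fun r hr => absurd hr (hκ r).ne') hκlim

lemma isExcursionExponent_steps : IsExcursionExponent steps (-4) := by
  obtain ⟨b, hb, h⟩ : ∃ b : ℝ, 0 < b ∧ b ^ 4 = 3 :=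
    ⟨3 ^ ((4 : ℝ)⁻¹), by positivity, by
      rw [← Real.rpow_natCast, ← Real.rpow_mul (by norm_num)]
      norm_num⟩
  obtain ⟨h1, h2, -, h4⟩ := critical_point_data hb h
  refine ⟨b ^ 2, b, (isPosCritical_steps_iff _ _).mpr ⟨hb, rfl, h⟩, ?_, ?_, ?_,
    excursion_exponent_eq hb h, ?_⟩
  · intro a' b' hc
    obtain ⟨hb', rfl, h'⟩ := (isPosCritical_steps_iff _ _).mp hc
    obtain rfl := eq_of_pow_four_eq hb' hb h' h
    exact ⟨rfl, rfl⟩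
  · rw [h1]; positivity
  · rw [h2]; positivity
  · rw [h4]
    exact hasGrowth_excursions hb h

lemma isWalkExponent_steps : IsWalkExponent steps (-4) :=
  ⟨8 / 3 * 3 ^ ((4 : ℝ)⁻¹), hasGrowth_total (by positivity) (by
    rw [← Real.rpow_natCast, ← Real.rpow_mul (by norm_num)]
    norm_num)⟩

end QuadrantWalk

/-- The rational function `numer / denom`, seen as a power series in `t` with coefficients in
`ℚ[x, x⁻¹, y, y⁻¹]`, is the unique power series `R` with `denom * R = numer`. -/
theorem proposition7p2 :
    (∃! R : PowerSeries QuadrantWalk.Laurent,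
      QuadrantWalk.denom * R = PowerSeries.C QuadrantWalk.numer) ∧
    (∀ R : PowerSeries QuadrantWalk.Laurent,
      QuadrantWalk.denom * R = PowerSeries.C QuadrantWalk.numer →
        QuadrantWalk.Q QuadrantWalk.steps = QuadrantWalk.nonnegPart R) ∧
    (∀ i j n : ℕ, (¬ ∃ m : ℕ, n = 2 * i + j + 4 * m) →
      QuadrantWalk.q QuadrantWalk.steps ((i : ℤ), (j : ℤ)) n = 0) ∧
    (∀ i j m n : ℕ, n = 2 * i + j + 4 * m →
      (QuadrantWalk.q QuadrantWalk.steps ((i : ℤ), (j : ℤ)) n : ℚ) =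
        (((i + 1) * (j + 1) * (i + j + 2) * n.factorial * (n + 2).factorial : ℕ) : ℚ) /
          ((m.factorial * (3 * m + 2 * i + j + 2).factorial * (2 * m + i + 1).factorial *
            (2 * m + i + j + 2).factorial : ℕ) : ℚ)) ∧
    QuadrantWalk.IsExcursionExponent QuadrantWalk.steps (-4) ∧
    QuadrantWalk.IsWalkExponent QuadrantWalk.steps (-4) := by
  exact ⟨QuadrantWalk.existsUnique_quotient, fun _ hR => QuadrantWalk.Q_eq_nonnegPart hR,
    fun _ _ _ h => QuadrantWalk.q_steps_eq_zero h, fun _ _ _ _ h => QuadrantWalk.q_steps_eq h,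
    QuadrantWalk.isExcursionExponent_steps, QuadrantWalk.isWalkExponent_steps⟩
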